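/- Let $\gamma>0$. Call a function on $\mathbb{R}$ of class $C_p^0$ if it has only finitely many discontinuities in every bounded interval and is (absolutely) integrable on every bounded interval. For $l\ge 0$, call a continuous function of class $C_p^{l+1}$ if it is differentiable, except possibly at finitely many points of every bounded interval, and its derivative is of class $C_p^{l}$. Let $V:\mathbb{R}\to\mathbb{R}$ be $\gamma$-periodic and of class $C_p^0$, and let $\lambda\in\mathbb{R}$. A classical solution of $$-\psi''+V\psi=\lambda\psi \qquad (*)$$ is a function $\psi:\mathbb{R}\to\mathbb{C}$ of class $C_p^2$ (in particular $\psi$ is continuously differentiable) which is twice differentiable and satisfies $(*)$ at every point where $V$ is continuous. A Bloch solution with quasimomentum $k\in\mathbb{C}$ is a classical solution of $(*)$ of the form $e^{\mathrm{i}kx}p(x)$ with $p:\mathbb{R}\to\mathbb{C}$ $\gamma$-periodic. Theorem. Let $\psi$ be a classical solution of $(*)$ that is bounded on $\mathbb{R}$. Then either $\psi$ is a Bloch solution with a real quasimomentum, or $\psi=c_1\varphi_1+c_2\varphi_2$ with $c_1,c_2\in\mathbb{C}$ and two not identically vanishing Bloch solutions $\varphi_1,\varphi_2$ of $(*)$ (for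 the same $\lambda$) with real quasimomenta. Moreover, if $\psi\not\equiv0$, the quasimomenta are real in every such representation: if $\psi$ is a Bloch solution with quasimomentum $k\in\mathbb{C}$, then $k\in\mathbb{R}$; and if $\psi=c_1\varphi_1+c_2\varphi_2$ with $c_1,c_2\in\mathbb{C}\setminus\{0\}$ and not identically vanishing Bloch solutions $\varphi_1,\varphi_2$ of $(*)$ with quasimomenta $k_1,k_2\in\mathbb{C}$, then $k_1,k_2\in\mathbb{R}$. -/

import Mathlib

open MeasureTheory

/-- A set of reals having only finitely many points in every bounded interval. -/
def FiniteOnBounded (S : Set ℝ) : Prop :=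
  ∀ a b : ℝ, (S ∩ Set.Icc a b).Finite

/-- The class `C_p^l` of functions on the line.

* `C_p^0`: the piecewise-continuous functions (finitely many discontinuities on every bounded
  interval, no requirement on one-sided limits) which are integrable on bounded intervals.
* `C_p^(l+1)`: the continuous functions which are differentiable, except possibly at finitely many
  points of every bounded interval, with derivative in `C_p^l`. For `l ≥ 1` the derivative is
  continuous, so that the function is then differentiable at every point. -/
def IsCp {E : Type*} [NormedAddCommGroup E] [NormedSpace ℝ E] : ℕ → (ℝ → E) → Prop
  | 0, f => FiniteOnBounded {x | ¬ ContinuousAt f x} ∧ LocallyIntegrable f volume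
  | l + 1, f => Continuous f ∧ FiniteOnBounded {x | ¬ DifferentiableAt ℝ f x} ∧ IsCp l (deriv f)

/-- The class `C_{p,γ}^l`: the `γ`-periodic members of `C_p^l`. -/
def IsCpPeriodic {E : Type*} [NormedAddCommGroup E] [NormedSpace ℝ E]
    (γ : ℝ) (l : ℕ) (f : ℝ → E) : Prop :=
  IsCp l f ∧ Function.Periodic f γ

/-- `ψ` is a classical solution of `-ψ'' + V ψ = lam ψ`: it is of class `C_p^2`, and the equation
holds, with an actual second derivative, at every point where the potential is continuous
(at every point of the line, when `V` is continuous). -/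
def IsClassicalSolution (V : ℝ → ℝ) (lam : ℝ) (ψ : ℝ → ℂ) : Prop :=
  IsCp 2 ψ ∧ ∀ x : ℝ, ContinuousAt V x →
    DifferentiableAt ℝ (deriv ψ) x ∧
      -deriv (deriv ψ) x + (V x : ℂ) * ψ x = (lam : ℂ) * ψ x

/-- `ψ` is a Bloch solution of `-ψ'' + V ψ = lam ψ` with quasimomentum `k`: a classical solution of
the form `ψ x = exp (i k x) * p x` with `p` periodic of period `γ`. -/
def IsBlochSolution (γ : ℝ) (V : ℝ → ℝ) (lam : ℝ) (k : ℂ) (ψ : ℝ → ℂ) : Prop :=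
  IsClassicalSolution V lam ψ ∧
    ∃ p : ℝ → ℂ, Function.Periodic p γ ∧
      ∀ x : ℝ, ψ x = Complex.exp (Complex.I * k * (x : ℂ)) * p x

/-! ### Sets with finitely many points in every bounded interval -/

/-! Let `T` be translation by `γ`; it maps solutions to solutions because `V` is periodic. A
solution is fixed by its value and slope at one point, so `ψ`, `Tψ`, `T²ψ` are linearly dependent:
either `ψ` is an eigenvector of `T`, or `(T - μ₁)(T - μ₂)ψ = 0`. In the second case `(T - μ₂)ψ` and
`(T - μ₁)ψ` are nonzero bounded eigenvectors, so `|μᵢ| = 1`; if `μ₁ ≠ μ₂` their difference is a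
multiple of `ψ`, and `μ₁ = μ₂` would force linear growth. Only uniqueness for the initial value
problem is needed, not existence. Conversely, `T - μ₂` removes `φ₂` from a given combination, so
`φ₁` is bounded and its multiplier unimodular. -/

theorem FiniteOnBounded.countable {S : Set ℝ} (hS : FiniteOnBounded S) : S.Countable := by
  have h : S = ⋃ n : ℕ, S ∩ Set.Icc (-(n : ℝ)) n := by
    ext x
    simp only [Set.mem_iUnion, Set.mem_inter_iff, exists_and_left]
    refine ⟨fun hx => ⟨hx, ?_⟩, fun hx => hx.1⟩
    obtain ⟨n, hn⟩ := exists_nat_ge |x|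
    exact ⟨n, abs_le.1 hn⟩
  rw [h]
  exact Set.countable_iUnion fun n => (hS _ _).countable

theorem FiniteOnBounded.mono {S T : Set ℝ} (hT : FiniteOnBounded T) (h : S ⊆ T) :
    FiniteOnBounded S :=
  fun a b => (hT a b).subset (Set.inter_subset_inter_left _ h)

/-- Makes the continuity set of `V` open, so the equation at one such point holds on a
neighbourhood. -/
theorem FiniteOnBounded.isClosed {S : Set ℝ} (hS : FiniteOnBounded S) : IsClosed S := by
  refine isClosed_of_closure_subset fun x hx => ?_
  have hc : IsClosed (S ∩ Set.Icc (x - 1) (x + 1)) := (hS _ _).isClosed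
  have hn : Set.Icc (x - 1) (x + 1) ∈ nhds x := Icc_mem_nhds (by linarith) (by linarith)
  have : x ∈ closure (S ∩ Set.Icc (x - 1) (x + 1)) := by
    rw [mem_closure_iff_nhds] at hx ⊢
    intro t ht
    obtain ⟨y, hy, hyS⟩ := hx (t ∩ Set.Icc (x - 1) (x + 1)) (Filter.inter_mem ht hn)
    exact ⟨y, hy.1, hyS, hy.2⟩
  rw [hc.closure_eq] at this
  exact this.1

/-! ### Classical solutions together with their derivative -/

/-- `g` is the continuous derivative of `f`, and `f'' = (V - lam) f` wherever `V` is continuous. -/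
structure IsSolutionPair (V : ℝ → ℝ) (lam : ℝ) (f g : ℝ → ℂ) : Prop where
  hasDerivAt : ∀ x, HasDerivAt f (g x) x
  continuous_deriv : Continuous g
  hasDerivAt_deriv : ∀ x, ContinuousAt V x → HasDerivAt g (((V x : ℂ) - lam) * f x) x

/-- A continuous function, differentiable off a countable set and with continuous derivative, is
differentiable everywhere. -/
theorem hasDerivAt_of_continuous_deriv {f : ℝ → ℂ} (hf : Continuous f)
    (hd : {x | ¬ DifferentiableAt ℝ f x}.Countable) (hc : Continuous (deriv f)) (x : ℝ) :
    HasDerivAt f (deriv f x) x := by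
  have h : ∀ y, ∫ t in (0 : ℝ)..y, deriv f t = f y - f 0 := fun y =>
    MeasureTheory.integral_eq_of_hasDerivAt_off_countable f (deriv f) hd hf.continuousOn
      (fun t ht => (not_not.1 ht.2 : DifferentiableAt ℝ f t).hasDerivAt) (hc.intervalIntegrable _ _)
  have h2 : f = fun y => (∫ t in (0 : ℝ)..y, deriv f t) + f 0 := by
    funext y; rw [h y]; ring
  have := (intervalIntegral.integral_hasDerivAt_right (hc.intervalIntegrable 0 x)
    hc.aestronglyMeasurable.stronglyMeasurableAtFilter hc.continuousAt).add_const (f 0)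
  rwa [← h2] at this

theorem IsClassicalSolution.isSolutionPair {V : ℝ → ℝ} {lam : ℝ} {f : ℝ → ℂ}
    (h : IsClassicalSolution V lam f) : IsSolutionPair V lam f (deriv f) := by
  obtain ⟨⟨h1, h2, h3, -, -⟩, h4⟩ := h
  refine ⟨hasDerivAt_of_continuous_deriv h1 h2.countable h3, h3, fun x hx => ?_⟩
  obtain ⟨h5, h6⟩ := h4 x hx
  have : ((V x : ℂ) - lam) * f x = deriv (deriv f) x := by linear_combination h6
  rw [this]
  exact h5.hasDerivAt

namespace IsSolutionPair

variable {V : ℝ → ℝ} {lam γ : ℝ} {f g f₁ g₁ f₂ g₂ : ℝ → ℂ}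

theorem continuous (h : IsSolutionPair V lam f g) : Continuous f :=
  continuous_iff_continuousAt.2 fun x => (h.hasDerivAt x).continuousAt

theorem linearCombination (h₁ : IsSolutionPair V lam f₁ g₁) (h₂ : IsSolutionPair V lam f₂ g₂)
    (a b : ℂ) :
    IsSolutionPair V lam (fun x => a * f₁ x + b * f₂ x) (fun x => a * g₁ x + b * g₂ x) where
  hasDerivAt x := ((h₁.hasDerivAt x).const_mul a).add ((h₂.hasDerivAt x).const_mul b)
  continuous_deriv :=
    (h₁.continuous_deriv.const_mul a).add (h₂.continuous_deriv.const_mul b)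
  hasDerivAt_deriv x hx := by
    refine (((h₁.hasDerivAt_deriv x hx).const_mul a).add
      ((h₂.hasDerivAt_deriv x hx).const_mul b)).congr_deriv ?_
    ring

theorem translate (hV : Function.Periodic V γ) (h : IsSolutionPair V lam f g) :
    IsSolutionPair V lam (fun x => f (x + γ)) (fun x => g (x + γ)) where
  hasDerivAt x := (h.hasDerivAt (x + γ)).comp_add_const x γ
  continuous_deriv := h.continuous_deriv.comp (continuous_add_const γ)
  hasDerivAt_deriv x hx := by
    have hVc : ContinuousAt V (x + γ) := by
      have h1 : V = fun y => V (y - γ) := funext fun y => (hV.sub_eq y).symm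
      rw [h1]
      refine ContinuousAt.comp (g := V) (f := fun y => y - γ) ?_ (by fun_prop)
      simpa using hx
    have := (h.hasDerivAt_deriv (x + γ) hVc).comp_add_const x γ
    rwa [hV x] at this

theorem locallyIntegrable_rhs (hV : LocallyIntegrable V volume) (h : IsSolutionPair V lam f g) :
    LocallyIntegrable (fun x => ((V x : ℂ) - lam) * f x) volume := by
  have hW : LocallyIntegrable (fun x => (V x : ℂ) - lam) volume := by
    refine LocallyIntegrable.sub (fun x => ?_) (locallyIntegrable_const _)
    obtain ⟨s, hs, hi⟩ := hV x
    exact ⟨s, hs, hi.ofReal⟩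
  rw [← locallyIntegrableOn_univ] at hW ⊢
  exact hW.mul_continuousOn h.continuous.continuousOn isOpen_univ.isLocallyClosed

/-- Returns from pairs to classical solutions, as needed for the eigenvectors `(T - μ)ψ`. The bad
points of `g` and `deriv g` lie among the discontinuities of `V`. -/
theorem isClassicalSolution (hV : IsCp 0 V) (h : IsSolutionPair V lam f g) :
    IsClassicalSolution V lam f := by
  have hfg : deriv f = g := funext fun x => (h.hasDerivAt x).deriv
  have hdd : ∀ x, ContinuousAt V x → deriv g x = ((V x : ℂ) - lam) * f x :=
    fun x hx => (h.hasDerivAt_deriv x hx).deriv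
  obtain ⟨hVd, hVi⟩ := hV
  have hev : ∀ x, ContinuousAt V x → ∀ᶠ y in nhds x, ContinuousAt V y := fun x hx => by
    have := hVd.isClosed.isOpen_compl.mem_nhds (x := x) (by simpa using hx)
    filter_upwards [this] with y hy
    simpa using hy
  refine ⟨⟨h.continuous, ?_, ?_⟩, fun x hx => ?_⟩
  · refine hVd.mono fun x hx => (hx (h.hasDerivAt x).differentiableAt).elim
  · rw [hfg]
    refine ⟨h.continuous_deriv, ?_, ?_, ?_⟩
    · exact hVd.mono fun x hx hxV => hx (h.hasDerivAt_deriv x hxV).differentiableAt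
    · refine hVd.mono fun x hx hxV => hx ?_
      have hc : ContinuousAt (fun y => ((V y : ℂ) - lam) * f y) x :=
        ((Complex.continuous_ofReal.continuousAt.comp hxV).sub continuousAt_const).mul
          h.continuous.continuousAt
      refine hc.congr ?_
      filter_upwards [hev x hxV] with y hy using (hdd y hy).symm
    · refine (h.locallyIntegrable_rhs hVi).congr ?_
      have : ∀ᵐ x, x ∉ {x | ¬ ContinuousAt V x} := hVd.countable.ae_notMem volume
      filter_upwards [this] with x hx using (hdd x (not_not.1 hx)).symm
  · rw [hfg]
    refine ⟨(h.hasDerivAt_deriv x hx).differentiableAt, ?_⟩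
    rw [hdd x hx]
    ring

/-- Zero initial data at a point force the solution to vanish near that point. -/
theorem eventually_eq_zero (hV : IsCp 0 V) (h : IsSolutionPair V lam f g) {x₀ : ℝ}
    (hf : f x₀ = 0) (hg : g x₀ = 0) : ∀ᶠ x in nhds x₀, f x = 0 ∧ g x = 0 := by
  obtain ⟨hVd, hVi⟩ := hV
  have hW : LocallyIntegrable (fun x => ‖V x - lam‖) volume :=
    fun x => by
      obtain ⟨s, hs, hi⟩ := hVi.sub (locallyIntegrable_const lam) x
      exact ⟨s, hs, hi.norm⟩
  have hWi : ∀ a b, IntervalIntegrable (fun x => ‖V x - lam‖) volume a b :=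
    fun a b => (hW.integrableOn_isCompact isCompact_uIcc).intervalIntegrable
  have hcont : Continuous fun x => ∫ t in x₀..x, ‖V t - lam‖ :=
    intervalIntegral.continuous_primitive hWi x₀
  have hsmall : ∀ᶠ x in nhds x₀, |∫ t in x₀..x, ‖V t - lam‖| < 1 / 2 := by
    have : Filter.Tendsto (fun x => |∫ t in x₀..x, ‖V t - lam‖|) (nhds x₀) (nhds 0) := by
      simpa using (hcont.abs.tendsto x₀)
    exact this.eventually_lt_const (by norm_num)
  obtain ⟨ε, hε, hball⟩ := Metric.eventually_nhds_iff.1 hsmall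
  -- With `δ ≤ 1/2` and `∫|V - lam| < 1/2`, integration gives `sup|f| ≤ sup|g|/2` and `sup|g| ≤
  -- sup|f|/2` on `I`, so both vanish. `V` may be unbounded, hence the integral.
  set δ : ℝ := min (ε / 2) (1 / 2) with hδ
  have hδ0 : 0 < δ := by positivity
  have hδε : δ < ε := (min_le_left _ _).trans_lt (by linarith)
  have hδ2 : δ ≤ 1 / 2 := min_le_right _ _
  set I := Set.Icc (x₀ - δ) (x₀ + δ) with hI
  have hx₀ : x₀ ∈ I := ⟨by linarith, by linarith⟩
  have hIcomp : IsCompact I := isCompact_Icc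
  obtain ⟨y₁, hy₁, hmax₁⟩ := hIcomp.exists_isMaxOn ⟨x₀, hx₀⟩ h.continuous.norm.continuousOn
  obtain ⟨y₂, hy₂, hmax₂⟩ := hIcomp.exists_isMaxOn ⟨x₀, hx₀⟩ h.continuous_deriv.norm.continuousOn
  have hsub : ∀ y ∈ I, Set.uIoc x₀ y ⊆ I := fun y hy =>
    Set.uIoc_subset_uIcc.trans (Set.ordConnected_Icc.uIcc_subset hx₀ hy)
  have hdist : ∀ y ∈ I, |y - x₀| ≤ δ := fun y hy =>
    abs_le.2 ⟨by linarith [hy.1], by linarith [hy.2]⟩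
  have hf1 : ∀ y ∈ I, ‖f y‖ ≤ 1 / 2 * ‖g y₂‖ := fun y hy => by
    have e : ∫ t in x₀..y, g t = f y := by
      rw [intervalIntegral.integral_eq_sub_of_hasDerivAt (fun t _ => h.hasDerivAt t)
        (h.continuous_deriv.intervalIntegrable _ _), hf, sub_zero]
    have := intervalIntegral.norm_integral_le_of_norm_le_const (C := ‖g y₂‖) (f := g)
      fun t ht => hmax₂ (hsub y hy ht)
    rw [e] at this
    have h3 := (hdist y hy).trans hδ2
    nlinarith [norm_nonneg (g y₂)]
  have hg1 : ∀ y ∈ I, ‖g y‖ ≤ 1 / 2 * ‖f y₁‖ := fun y hy => by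
    have e : ∫ t in x₀..y, ((V t : ℂ) - lam) * f t = g y := by
      rw [MeasureTheory.integral_eq_of_hasDerivAt_off_countable g _ hVd.countable
        h.continuous_deriv.continuousOn (fun t ht => h.hasDerivAt_deriv t (not_not.1 ht.2))
        ((h.locallyIntegrable_rhs hVi).integrableOn_isCompact isCompact_uIcc).intervalIntegrable, hg, sub_zero]
    have hle : ‖∫ t in x₀..y, ((V t : ℂ) - lam) * f t‖ ≤
        |∫ t in x₀..y, ‖V t - lam‖ * ‖f y₁‖| := by
      refine intervalIntegral.norm_integral_le_abs_of_norm_le ?_ ((hWi _ _).mul_const _)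
      refine (ae_restrict_iff' measurableSet_uIoc).2 (Filter.Eventually.of_forall fun t ht => ?_)
      rw [norm_mul, ← Complex.ofReal_sub, Complex.norm_real]
      exact mul_le_mul_of_nonneg_left (hmax₁ (hsub y hy ht)) (norm_nonneg _)
    rw [e, intervalIntegral.integral_mul_const, abs_mul, abs_norm] at hle
    have h3 := hball (y := y) (by rw [Real.dist_eq]; exact (hdist y hy).trans_lt hδε)
    nlinarith [norm_nonneg (f y₁)]
  have hz1 : ‖f y₁‖ ≤ 0 := by linarith [hf1 y₁ hy₁, hg1 y₂ hy₂, norm_nonneg (f y₁)]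
  have hz2 : ‖g y₂‖ ≤ 0 := by linarith [hg1 y₂ hy₂]
  filter_upwards [Icc_mem_nhds (show x₀ - δ < x₀ by linarith) (show x₀ < x₀ + δ by linarith)]
    with y hy
  exact ⟨norm_le_zero_iff.1 (by linarith [hf1 y hy]), norm_le_zero_iff.1 (by linarith [hg1 y hy])⟩

/-- Solutions are determined by their initial data. -/
theorem eq_zero (hV : IsCp 0 V) (h : IsSolutionPair V lam f g) {x₀ : ℝ}
    (hf : f x₀ = 0) (hg : g x₀ = 0) (x : ℝ) : f x = 0 := by
  have hclopen : IsClopen {x | f x = 0 ∧ g x = 0} := by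
    refine ⟨(isClosed_eq h.continuous continuous_const).inter
      (isClosed_eq h.continuous_deriv continuous_const), ?_⟩
    exact isOpen_iff_mem_nhds.2 fun y hy => h.eventually_eq_zero hV hy.1 hy.2
  have := hclopen.eq_univ ⟨x₀, hf, hg⟩
  exact (this.symm ▸ Set.mem_univ x : x ∈ {x | f x = 0 ∧ g x = 0}).1

end IsSolutionPair

/-! ### Multipliers of quasi-periodic functions -/

theorem quasiperiodic_iterate {γ : ℝ} {φ : ℝ → ℂ} {μ : ℂ} (h : ∀ x, φ (x + γ) = μ * φ x)
    (n : ℕ) (x : ℝ) : φ (x + n * γ) = μ ^ n * φ x := by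
  induction n with
  | zero => simp
  | succ n ih =>
    rw [show x + ((n + 1 : ℕ) : ℝ) * γ = x + n * γ + γ by push_cast; ring, h, ih]
    ring

/-- The multiplier of a nonzero bounded quasi-periodic function has modulus one. -/
theorem norm_multiplier_eq_one {γ : ℝ} {φ : ℝ → ℂ} {μ : ℂ} (h : ∀ x, φ (x + γ) = μ * φ x)
    (hφ : φ ≠ 0) (hb : ∃ C : ℝ, ∀ x, ‖φ x‖ ≤ C) : ‖μ‖ = 1 := by
  obtain ⟨C, hC⟩ := hb
  obtain ⟨x, hx⟩ := Function.ne_iff.1 hφ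
  have hx : 0 < ‖φ x‖ := norm_pos_iff.2 hx
  refine le_antisymm (le_of_not_gt fun hμ => ?_) (le_of_not_gt fun hμ => ?_)
  · obtain ⟨n, hn⟩ := pow_unbounded_of_one_lt (C / ‖φ x‖) hμ
    have h1 := hC (x + n * γ)
    rw [quasiperiodic_iterate h, norm_mul, norm_pow] at h1
    rw [div_lt_iff₀ hx] at hn
    linarith
  -- For `|μ| < 1` the growth occurs towards the left: start from `x - nγ`.
  · have hC0 : 0 < C := hx.trans_le (hC x)
    obtain ⟨n, hn⟩ := exists_pow_lt_of_lt_one (div_pos hx hC0) hμ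
    have h1 := quasiperiodic_iterate h n (x - n * γ)
    rw [sub_add_cancel] at h1
    have h2 : ‖φ x‖ ≤ ‖μ‖ ^ n * C := by
      rw [h1, norm_mul, norm_pow]
      exact mul_le_mul_of_nonneg_left (hC _) (by positivity)
    rw [lt_div_iff₀ hC0] at hn
    linarith

/-- There is no bounded Jordan chain of length two for the translation operator. -/
theorem not_bounded_of_jordan_chain {γ : ℝ} {ψ φ : ℝ → ℂ} {μ : ℂ} (hφ : φ ≠ 0)
    (h : ∀ x, φ (x + γ) = μ * φ x) (hψ : ∀ x, ψ (x + γ) = μ * ψ x + φ x)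
    (hb : ∃ C : ℝ, ∀ x, ‖ψ x‖ ≤ C) : False := by
  obtain ⟨C, hC⟩ := hb
  have hC0 : 0 ≤ C := (norm_nonneg _).trans (hC 0)
  have hφe : ∀ x, φ x = ψ (x + γ) - μ * ψ x := fun x => by rw [hψ]; ring
  have hμ : ‖μ‖ = 1 := norm_multiplier_eq_one h hφ ⟨C + ‖μ‖ * C, fun x => by
    rw [hφe]
    refine (norm_sub_le _ _).trans (add_le_add (hC _) ?_)
    rw [norm_mul]
    exact mul_le_mul_of_nonneg_left (hC _) (norm_nonneg _)⟩
  obtain ⟨x, hx⟩ := Function.ne_iff.1 hφ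
  have hx : 0 < ‖φ x‖ := norm_pos_iff.2 hx
  -- The extra factor `μ` avoids `μ ^ (n - 1)` in `Tⁿψ = μⁿψ + nμⁿ⁻¹φ`.
  have hiter : ∀ n : ℕ, μ * ψ (x + n * γ) = μ ^ n * (μ * ψ x + n * φ x) := by
    intro n
    induction n with
    | zero => simp
    | succ n ih =>
      rw [show x + ((n + 1 : ℕ) : ℝ) * γ = x + n * γ + γ by push_cast; ring, hψ, mul_add, ih,
        quasiperiodic_iterate h]
      push_cast
      ring
  obtain ⟨n, hn⟩ := exists_nat_gt (2 * C / ‖φ x‖)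
  rw [div_lt_iff₀ hx] at hn
  have h1 := congrArg norm (hiter n)
  rw [norm_mul, norm_mul, norm_pow, hμ, one_pow, one_mul, one_mul] at h1
  have h2 : ‖(n : ℂ) * φ x‖ ≤ ‖μ * ψ x + n * φ x‖ + ‖μ * ψ x‖ := by
    simpa using norm_sub_le (μ * ψ x + n * φ x) (μ * ψ x)
  rw [norm_mul, norm_mul, hμ, one_mul, Complex.norm_natCast] at h2
  linarith [hC x, hC (x + n * γ)]

/-! ### Quasimomenta and multipliers -/

theorem IsBlochSolution.map_add_period {γ : ℝ} {V : ℝ → ℝ} {lam : ℝ} {k : ℂ} {φ : ℝ → ℂ}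
    (h : IsBlochSolution γ V lam k φ) (x : ℝ) :
    φ (x + γ) = Complex.exp (Complex.I * k * γ) * φ x := by
  obtain ⟨-, p, hp, hφ⟩ := h
  rw [hφ, hφ, hp, Complex.ofReal_add, mul_add, Complex.exp_add]
  ring

theorem im_eq_zero_of_norm_multiplier_eq_one {γ : ℝ} (hγ : 0 < γ) {k : ℂ}
    (h : ‖Complex.exp (Complex.I * k * γ)‖ = 1) : k.im = 0 := by
  rw [Complex.norm_exp, Real.exp_eq_one_iff] at h
  have h2 : -(k.im * γ) = 0 := by simpa using h
  simpa [hγ.ne'] using h2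

/-- A quasi-periodic classical solution with unimodular multiplier is a Bloch solution with real
quasimomentum. -/
theorem IsClassicalSolution.exists_isBlochSolution {γ : ℝ} (hγ : 0 < γ) {V : ℝ → ℝ} {lam : ℝ}
    {φ : ℝ → ℂ} (hφ : IsClassicalSolution V lam φ) {μ : ℂ} (hμ : ‖μ‖ = 1)
    (h : ∀ x, φ (x + γ) = μ * φ x) : ∃ k : ℂ, k.im = 0 ∧ IsBlochSolution γ V lam k φ := by
  have hγ' : (γ : ℂ) ≠ 0 := Complex.ofReal_ne_zero.2 hγ.ne'
  have hexp : Complex.exp (Complex.I * ((μ.arg / γ : ℝ) : ℂ) * γ) = μ := by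
    have h1 := Complex.norm_mul_exp_arg_mul_I μ
    rw [hμ, Complex.ofReal_one, one_mul] at h1
    rw [show Complex.I * ((μ.arg / γ : ℝ) : ℂ) * γ = μ.arg * Complex.I by
      push_cast; field_simp, h1]
  set k : ℂ := ((μ.arg / γ : ℝ) : ℂ) with hk
  refine ⟨k, Complex.ofReal_im _, hφ, fun x => Complex.exp (-(Complex.I * k * x)) * φ x,
    fun x => ?_, fun x => ?_⟩
  · have : Complex.exp (-(Complex.I * k * ((x + γ : ℝ) : ℂ))) * μ =
        Complex.exp (-(Complex.I * k * x)) := by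
      conv_lhs => rw [← hexp]
      rw [← Complex.exp_add]
      congr 1
      push_cast
      ring
    simp only [h]
    rw [← mul_assoc, this]
  · rw [← mul_assoc, ← Complex.exp_add, add_neg_cancel, Complex.exp_zero, one_mul]

/-! ### Decomposition of bounded solutions -/

/-- A classical solution is either quasi-periodic under translation by the period, or
satisfies a second order linear recurrence and is not quasi-periodic. -/
theorem IsClassicalSolution.translate_dichotomy {γ : ℝ} {V : ℝ → ℝ} (hV : IsCpPeriodic γ 0 V)
    {lam : ℝ} {ψ : ℝ → ℂ} (hψ : IsClassicalSolution V lam ψ) :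
    (∃ μ : ℂ, ∀ x, ψ (x + γ) = μ * ψ x) ∨
      ((∀ μ : ℂ, (fun x => ψ (x + γ) - μ * ψ x) ≠ 0) ∧
        ∃ a b : ℂ, ∀ x, ψ (x + γ + γ) = a * ψ (x + γ) + b * ψ x) := by
  obtain ⟨hV0, hVp⟩ := hV
  by_cases hq : ∃ μ : ℂ, ∀ x, ψ (x + γ) = μ * ψ x
  · exact Or.inl hq
  refine Or.inr ⟨fun μ h0 => hq ⟨μ, fun x => sub_eq_zero.1 (congrFun h0 x)⟩, ?_⟩
  have s₀ := hψ.isSolutionPair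
  have s₁ := s₀.translate hVp
  have s₂ := s₁.translate hVp
  set g := deriv ψ
  have hprop : ∀ μ : ℂ, ψ (0 + γ) = μ * ψ 0 → g (0 + γ) = μ * g 0 → False := fun μ h1 h2 =>
    hq ⟨μ, fun x => by
      have := (s₁.linearCombination s₀ 1 (-μ)).eq_zero hV0 (x₀ := 0)
        (by linear_combination h1) (by linear_combination h2) x
      linear_combination this⟩
  -- The Wronskian of `ψ` and `Tψ` at `0`: if it vanished, proportional initial data would make `ψ`
  -- quasi-periodic.
  have hd : ψ 0 * g (0 + γ) - g 0 * ψ (0 + γ) ≠ 0 := fun hd => by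
    by_cases h1 : ψ 0 = 0
    · by_cases h2 : g 0 = 0
      · refine hq ⟨0, fun x => ?_⟩
        rw [s₀.eq_zero hV0 h1 h2, zero_mul]
      · rw [h1, zero_mul, zero_sub, neg_eq_zero, mul_eq_zero, or_iff_right h2] at hd
        exact hprop (g (0 + γ) / g 0) (by rw [hd, h1, mul_zero]) (by field_simp)
    · exact hprop (ψ (0 + γ) / ψ 0) (by field_simp) (by field_simp; linear_combination hd)
  set d := ψ 0 * g (0 + γ) - g 0 * ψ (0 + γ) with hd'
  -- Cramer's rule for the initial data of `T²ψ`.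
  set a := (ψ 0 * g (0 + γ + γ) - g 0 * ψ (0 + γ + γ)) / d with ha
  set b := (ψ (0 + γ + γ) * g (0 + γ) - g (0 + γ + γ) * ψ (0 + γ)) / d with hb
  have had : a * d = ψ 0 * g (0 + γ + γ) - g 0 * ψ (0 + γ + γ) := div_mul_cancel₀ _ hd
  have hbd : b * d = ψ (0 + γ + γ) * g (0 + γ) - g (0 + γ + γ) * ψ (0 + γ) := div_mul_cancel₀ _ hd
  refine ⟨a, b, fun x => ?_⟩
  have h1 : ψ (0 + γ + γ) = a * ψ (0 + γ) + b * ψ 0 := by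
    refine mul_right_cancel₀ hd ?_
    linear_combination (-ψ (0 + γ)) * had - ψ 0 * hbd + ψ (0 + γ + γ) * hd'
  have h2 : g (0 + γ + γ) = a * g (0 + γ) + b * g 0 := by
    refine mul_right_cancel₀ hd ?_
    linear_combination (-g (0 + γ)) * had - g 0 * hbd + g (0 + γ + γ) * hd'
  have := (s₂.linearCombination (s₁.linearCombination s₀ a b) 1 (-1)).eq_zero hV0 (x₀ := 0)
    (by linear_combination h1) (by linear_combination h2) x
  linear_combination this

theorem exists_roots_of_recurrence (a b : ℂ) : ∃ μ₁ μ₂ : ℂ, a = μ₁ + μ₂ ∧ b = -(μ₁ * μ₂) := by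
  obtain ⟨s, hs⟩ := IsAlgClosed.exists_pow_nat_eq (a ^ 2 + 4 * b) (n := 2) (by norm_num)
  exact ⟨(a + s) / 2, (a - s) / 2, by ring, by linear_combination -hs / 4⟩

theorem bounded_linearCombination {f₁ f₂ : ℝ → ℂ} (h₁ : ∃ C : ℝ, ∀ x, ‖f₁ x‖ ≤ C)
    (h₂ : ∃ C : ℝ, ∀ x, ‖f₂ x‖ ≤ C) (a b : ℂ) :
    ∃ C : ℝ, ∀ x, ‖a * f₁ x + b * f₂ x‖ ≤ C := by
  obtain ⟨C₁, h₁⟩ := h₁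
  obtain ⟨C₂, h₂⟩ := h₂
  refine ⟨‖a‖ * C₁ + ‖b‖ * C₂, fun x => (norm_add_le _ _).trans ?_⟩
  rw [norm_mul, norm_mul]
  gcongr
  exacts [h₁ x, h₂ x]

theorem IsClassicalSolution.bloch_of_bounded {γ : ℝ} (hγ : 0 < γ) {V : ℝ → ℝ}
    (hV : IsCpPeriodic γ 0 V) {lam : ℝ} {ψ : ℝ → ℂ} (hψ : IsClassicalSolution V lam ψ)
    (hbdd : ∃ C : ℝ, ∀ x : ℝ, ‖ψ x‖ ≤ C) :
    (∃ k : ℂ, k.im = 0 ∧ IsBlochSolution γ V lam k ψ) ∨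
      (∃ (k₁ k₂ : ℂ) (φ₁ φ₂ : ℝ → ℂ) (c₁ c₂ : ℂ),
        k₁.im = 0 ∧ k₂.im = 0 ∧ φ₁ ≠ 0 ∧ φ₂ ≠ 0 ∧
        IsBlochSolution γ V lam k₁ φ₁ ∧ IsBlochSolution γ V lam k₂ φ₂ ∧
        ∀ x : ℝ, ψ x = c₁ * φ₁ x + c₂ * φ₂ x) := by
  rcases hψ.translate_dichotomy hV with ⟨μ, hμ⟩ | ⟨hne, a, b, hrec⟩
  · left
    by_cases h0 : ψ = 0
    · exact hψ.exists_isBlochSolution hγ (μ := 1) norm_one fun x => by simp [h0]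
    · exact hψ.exists_isBlochSolution hγ (norm_multiplier_eq_one hμ h0 hbdd) hμ
  · obtain ⟨μ₁, μ₂, rfl, rfl⟩ := exists_roots_of_recurrence a b
    have hbγ : ∃ C : ℝ, ∀ x : ℝ, ‖ψ (x + γ)‖ ≤ C := hbdd.imp fun C hC x => hC _
    -- Stated for either ordering of the roots, since both factors of the quadratic are used.
    have key : ∀ μ ν : ℂ, μ₁ + μ₂ = μ + ν → μ₁ * μ₂ = μ * ν →
        (∀ x, ψ (x + γ + γ) - ν * ψ (x + γ) = μ * (ψ (x + γ) - ν * ψ x)) ∧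
        ∃ k : ℂ, k.im = 0 ∧ IsBlochSolution γ V lam k fun x => ψ (x + γ) - ν * ψ x := by
      intro μ ν h1 h2
      have hq : ∀ x, ψ (x + γ + γ) - ν * ψ (x + γ) = μ * (ψ (x + γ) - ν * ψ x) := fun x => by
        linear_combination hrec x + ψ (x + γ) * h1 - ψ x * h2
      have hb := bounded_linearCombination hbγ hbdd 1 (-ν)
      have hs := ((hψ.isSolutionPair.translate hV.2).linearCombination hψ.isSolutionPair
        1 (-ν)).isClassicalSolution hV.1
      simp only [one_mul, neg_mul, ← sub_eq_add_neg] at hb hs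
      exact ⟨hq, hs.exists_isBlochSolution hγ (norm_multiplier_eq_one hq (hne ν) hb) hq⟩
    by_cases hμ : μ₁ = μ₂
    · subst hμ
      exact (not_bounded_of_jordan_chain (hne μ₁) (key μ₁ μ₁ rfl rfl).1 (fun x => by ring)
        hbdd).elim
    · have hsub : μ₁ - μ₂ ≠ 0 := sub_ne_zero.2 hμ
      obtain ⟨-, k₁, hk₁, hB₁⟩ := key μ₁ μ₂ rfl rfl
      obtain ⟨-, k₂, hk₂, hB₂⟩ := key μ₂ μ₁ (add_comm _ _) (mul_comm _ _)
      -- `(T - μ₂)ψ - (T - μ₁)ψ = (μ₁ - μ₂)ψ`.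
      refine Or.inr ⟨k₁, k₂, _, _, (μ₁ - μ₂)⁻¹, -(μ₁ - μ₂)⁻¹, hk₁, hk₂, hne μ₂, hne μ₁, hB₁, hB₂,
        fun x => ?_⟩
      field_simp
      ring

/-- A nonzero component of a bounded combination of two quasi-periodic functions has unimodular
multiplier. -/
theorem norm_multiplier_eq_one_of_combination {γ : ℝ} {ψ φ₁ φ₂ : ℝ → ℂ} {μ₁ μ₂ c₁ c₂ : ℂ}
    (hψ : ψ ≠ 0) (hb : ∃ C : ℝ, ∀ x, ‖ψ x‖ ≤ C) (hc₁ : c₁ ≠ 0) (hφ₁ : φ₁ ≠ 0)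
    (h₁ : ∀ x, φ₁ (x + γ) = μ₁ * φ₁ x) (h₂ : ∀ x, φ₂ (x + γ) = μ₂ * φ₂ x)
    (h : ∀ x, ψ x = c₁ * φ₁ x + c₂ * φ₂ x) : ‖μ₁‖ = 1 := by
  by_cases hμ : μ₁ = μ₂
  · refine norm_multiplier_eq_one (γ := γ) (fun x => ?_) hψ hb
    rw [h, h, h₁, h₂, hμ]
    ring
  · have hsub : μ₁ - μ₂ ≠ 0 := sub_ne_zero.2 hμ
    refine norm_multiplier_eq_one h₁ hφ₁ ?_
    -- `(T - μ₂)ψ = c₁(μ₁ - μ₂)φ₁`, solved for `φ₁`.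
    obtain ⟨C, hC⟩ := bounded_linearCombination (f₁ := fun x => ψ (x + γ))
      (hb.imp fun C hC x => hC _) hb (c₁ * (μ₁ - μ₂))⁻¹ (-(μ₂ * (c₁ * (μ₁ - μ₂))⁻¹))
    refine ⟨C, fun x => ?_⟩
    convert hC x using 2
    rw [h, h, h₁, h₂]
    field_simp
    ring

theorem mainTheorem8 (γ : ℝ) (hγ : 0 < γ) (V : ℝ → ℝ) (hV : IsCpPeriodic γ 0 V)
    (lam : ℝ) (ψ : ℝ → ℂ) (hψ : IsClassicalSolution V lam ψ)
    (hbdd : ∃ C : ℝ, ∀ x : ℝ, ‖ψ x‖ ≤ C) :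
    -- a Bloch solution, or a linear combination of two, with real quasimomenta
    ((∃ k : ℂ, k.im = 0 ∧ IsBlochSolution γ V lam k ψ) ∨
      (∃ (k₁ k₂ : ℂ) (φ₁ φ₂ : ℝ → ℂ) (c₁ c₂ : ℂ),
        k₁.im = 0 ∧ k₂.im = 0 ∧ φ₁ ≠ 0 ∧ φ₂ ≠ 0 ∧
        IsBlochSolution γ V lam k₁ φ₁ ∧ IsBlochSolution γ V lam k₂ φ₂ ∧
        ∀ x : ℝ, ψ x = c₁ * φ₁ x + c₂ * φ₂ x)) ∧
    -- and in any such representation of a nontrivial `ψ` the quasimomenta are real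
    (ψ ≠ 0 →
      (∀ k : ℂ, IsBlochSolution γ V lam k ψ → k.im = 0) ∧
      (∀ (k₁ k₂ : ℂ) (φ₁ φ₂ : ℝ → ℂ) (c₁ c₂ : ℂ),
        c₁ ≠ 0 → c₂ ≠ 0 → φ₁ ≠ 0 → φ₂ ≠ 0 →
        IsBlochSolution γ V lam k₁ φ₁ → IsBlochSolution γ V lam k₂ φ₂ →
        (∀ x : ℝ, ψ x = c₁ * φ₁ x + c₂ * φ₂ x) → k₁.im = 0 ∧ k₂.im = 0)) := by
  refine ⟨hψ.bloch_of_bounded hγ hV hbdd, fun h0 => ⟨fun k hk => ?_, ?_⟩⟩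
  · exact im_eq_zero_of_norm_multiplier_eq_one hγ
      (norm_multiplier_eq_one hk.map_add_period h0 hbdd)
  · intro k₁ k₂ φ₁ φ₂ c₁ c₂ hc₁ hc₂ hφ₁ hφ₂ hB₁ hB₂ h
    exact ⟨im_eq_zero_of_norm_multiplier_eq_one hγ (norm_multiplier_eq_one_of_combination h0 hbdd
        hc₁ hφ₁ hB₁.map_add_period hB₂.map_add_period h),
      im_eq_zero_of_norm_multiplier_eq_one hγ (norm_multiplier_eq_one_of_combination h0 hbdd
        hc₂ hφ₂ hB₂.map_add_period hB₁.map_add_period fun x => (h x).trans (add_comm _ _))⟩
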